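/- Let $M$ be a nonempty compact smooth manifold without boundary and let $\mu$ be a smooth positive volume density on $M$ (in every chart $d\mu=r(x)\,dx$ with $r>0$ smooth; for instance the Riemannian volume of a Riemannian metric), with total mass $\mu(M)$. Let $$\mathrm{Dens}(M)=\Big\{\varrho=\rho\mu \;:\; \rho\in C^\infty(M),\ \rho>0,\ \int_M\rho\,d\mu=\mu(M)\Big\},$$ an open subset of an affine space over the Fréchet space $T\,\mathrm{Dens}(M)=\{u\mu : u\in C^\infty(M),\ \int_M u\,d\mu=0\}$, so that $\mathrm{Dens}(M)$ is a Fréchet manifold with one global affine chart and with this tangent space at every point. Equip it with the infinite-dimensional Fisher–Rao metric $$\mathcal{FR}_\varrho(\dot\varrho_1,\dot\varrho_2)=\int_M\frac{\dot\varrho_1}{\varrho}\,\frac{\dot\varrho_2}{\varrho}\,\varrho .$$ Then $\mathcal{FR}$ is a weak Riemannian metric on $\mathrm{Dens}(M)$ (symmetric, positive definite on each tangent space, jointly continuous, and smooth in $\varrho$), it has a Levi-Civita connection (symmetric, compatible with the metric), and its sectional curvature is constant and positive: for every $\varrho\in\mathrm{Dens}(M)$ and all linearly independent tangent vectors $u,v$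 at $\varrho$, $$\frac{\mathcal{FR}_\varrho(R(u,v)v,u)}{\mathcal{FR}_\varrho(u,u)\,\mathcal{FR}_\varrho(v,v)-\mathcal{FR}_\varrho(u,v)^2}=\frac{1}{4\,\mu(M)} .$$ Equivalently, in the normalization $\tfrac14\mathcal{FR}$, the sectional curvature is constant and equal to $1/\mu(M)$. -/

import Mathlib

open MeasureTheory Filter Set
open scoped Manifold ContDiff Topology UniformConvergence

noncomputable section

/-! ### Differential calculus and weak Riemannian geometry on an open set of a Fréchet space -/

section Calculus

variable {X Y : Type*} [AddCommGroup X] [Module ℝ X] [AddCommGroup Y] [Module ℝ Y]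
  [TopologicalSpace Y]

/-- `f` has the Gateaux (directional) derivative `l` at `p` in the direction `v`. -/
def HasGateauxDerivAt (f : X → Y) (p v : X) (l : Y) : Prop :=
  Tendsto (fun t : ℝ => t⁻¹ • (f (p + t • v) - f p)) (𝓝[≠] 0) (𝓝 l)

/-- The Gateaux derivative `df(p)v` (meaningful when the limit exists). -/
def gateauxDeriv (f : X → Y) (p v : X) : Y :=
  limUnder (𝓝[≠] (0 : ℝ)) (fun t : ℝ => t⁻¹ • (f (p + t • v) - f p))

/-- `f` is of class `C^∞` on the open set `U` in the sense of Gateaux derivatives: all iterated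
directional derivatives `D k p (h₁, …, h_k)` exist at the points of `U`, and each of them is jointly
continuous as a function of the point and of the directions. -/
def GateauxSmoothOn [TopologicalSpace X] (f : X → Y) (U : Set X) : Prop :=
  ∃ D : (k : ℕ) → X → (Fin k → X) → Y,
    (∀ p ∈ U, ∀ h, D 0 p h = f p) ∧
    (∀ k, ContinuousOn (fun q : X × (Fin k → X) => D k q.1 q.2) (U ×ˢ univ)) ∧
    ∀ k, ∀ p ∈ U, ∀ (h : Fin k → X) (v : X),
      HasGateauxDerivAt (fun q => D k q h) p v (D (k + 1) p (Fin.snoc h v : Fin (k + 1) → X))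

end Calculus

section Geometry

variable {X : Type*} [AddCommGroup X] [Module ℝ X] [TopologicalSpace X]

/-- `g` is a weak Riemannian metric on the open set `U` of `X`. -/
structure IsWeakRiemannianMetric (U : Set X) (g : X → X → X → ℝ) : Prop where
  isOpen : IsOpen U
  continuousOn : ContinuousOn (fun q : X × X × X => g q.1 q.2.1 q.2.2) (U ×ˢ univ)
  smooth : ∀ v w, GateauxSmoothOn (fun p => g p v w) U
  add_left : ∀ p ∈ U, ∀ v v' w, g p (v + v') w = g p v w + g p v' w
  smul_left : ∀ p ∈ U, ∀ (c : ℝ) (v w : X), g p (c • v) w = c * g p v w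
  symm : ∀ p ∈ U, ∀ v w, g p v w = g p w v
  pos : ∀ p ∈ U, ∀ v, v ≠ 0 → 0 < g p v v

/-- `Γ` is the Christoffel map of an affine connection on `U`. -/
structure IsAffineConnection (U : Set X) (Γ : X → X → X → X) : Prop where
  continuousOn : ContinuousOn (fun q : X × X × X => Γ q.1 q.2.1 q.2.2) (U ×ˢ univ)
  smooth : ∀ v w, GateauxSmoothOn (fun p => Γ p v w) U
  add_left : ∀ p ∈ U, ∀ v v' w, Γ p (v + v') w = Γ p v w + Γ p v' w
  smul_left : ∀ p ∈ U, ∀ (c : ℝ) (v w : X), Γ p (c • v) w = c • Γ p v w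
  add_right : ∀ p ∈ U, ∀ v w w', Γ p v (w + w') = Γ p v w + Γ p v w'
  smul_right : ∀ p ∈ U, ∀ (c : ℝ) (v w : X), Γ p v (c • w) = c • Γ p v w

/-- The covariant derivative `∇_V W = dW · V + Γ(V, W)` of vector fields. -/
def covariantDeriv (Γ : X → X → X → X) (V W : X → X) (p : X) : X :=
  gateauxDeriv W p (V p) + Γ p (V p) (W p)

/-- The connection given by `Γ` is a Levi-Civita connection of `g`: it is symmetric, and
`Z⟨V, W⟩ = ⟨∇_Z V, W⟩ + ⟨V, ∇_Z W⟩` for all smooth vector fields. -/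
structure IsLeviCivita (U : Set X) (g : X → X → X → ℝ) (Γ : X → X → X → X) : Prop where
  isAffineConnection : IsAffineConnection U Γ
  symm : ∀ p ∈ U, ∀ v w, Γ p v w = Γ p w v
  metric : ∀ Z V W : X → X, GateauxSmoothOn Z U → GateauxSmoothOn V U → GateauxSmoothOn W U →
    ∀ p ∈ U, HasGateauxDerivAt (fun q => g q (V q) (W q)) p (Z p)
      (g p (covariantDeriv Γ Z V p) (W p) + g p (V p) (covariantDeriv Γ Z W p))

/-- The curvature tensor `R(u, v)w` of a connection, that is, the value at `p` of
`∇_u ∇_v w - ∇_v ∇_u w - ∇_{[u, v]} w`, written out for constant extensions of `u`, `v`, `w`. -/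
def curvatureTensor (Γ : X → X → X → X) (p u v w : X) : X :=
  gateauxDeriv (fun q => Γ q v w) p u - gateauxDeriv (fun q => Γ q u w) p v
    + Γ p u (Γ p v w) - Γ p v (Γ p u w)

/-- The sectional curvature of the plane spanned by `u` and `v`. -/
def sectionalCurvature (g : X → X → X → ℝ) (Γ : X → X → X → X) (p u v : X) : ℝ :=
  g p (curvatureTensor Γ p u v v) u / (g p u u * g p v v - g p u v ^ 2)

/-- The metric `g` on `U` has a Levi-Civita connection, and the sectional curvature of every
tangent 2-plane at every point of `U` equals `K`. -/
def HasConstantSectionalCurvature (U : Set X) (g : X → X → X → ℝ) (K : ℝ) : Prop :=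
  (∃ Γ, IsLeviCivita U g Γ) ∧
    ∀ Γ, IsLeviCivita U g Γ → ∀ p ∈ U, ∀ u v : X, LinearIndependent ℝ ![u, v] →
      sectionalCurvature g Γ p u v = K

end Geometry

/-! ### Smooth densities on a compact manifold -/

section Densities

variable {n : ℕ} {M : Type*} [TopologicalSpace M] [ChartedSpace (EuclideanSpace ℝ (Fin n)) M]

/-- The usual topology of `C^∞(M)`: uniform convergence of all derivatives on compact subsets of
charts. -/
instance smoothFunctionTopology : TopologicalSpace C^∞⟮𝓡 n, M; ℝ⟯ :=
  ⨅ (e : atlas (EuclideanSpace ℝ (Fin n)) M) (k : ℕ),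
    TopologicalSpace.induced
      (fun f : C^∞⟮𝓡 n, M; ℝ⟯ =>
        UniformOnFun.ofFun {K : Set (EuclideanSpace ℝ (Fin n)) | IsCompact K ∧ K ⊆ e.1.target}
          (iteratedFDeriv ℝ k (fun x => f (e.1.symm x))))
      inferInstance

/-- `μ` is a smooth positive density (volume form) on `M`: in every smooth chart it has the form
`r(x) dx` with a smooth positive function `r`. -/
def IsSmoothVolume [MeasurableSpace M] (n : ℕ) [ChartedSpace (EuclideanSpace ℝ (Fin n)) M]
    (μ : Measure M) : Prop :=
  ∀ e ∈ IsManifold.maximalAtlas (𝓡 n) ∞ M, ∃ r : EuclideanSpace ℝ (Fin n) → ℝ,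
    ContDiffOn ℝ ∞ r e.target ∧ (∀ x ∈ e.target, 0 < r x) ∧
      (μ.restrict e.source).map e =
        (volume.restrict e.target).withDensity (fun x => ENNReal.ofReal (r x))

variable [CompactSpace M] [MeasurableSpace M] [BorelSpace M]

theorem smoothFunction_integrable (μ : Measure M) [IsFiniteMeasure μ] (f : C^∞⟮𝓡 n, M; ℝ⟯) :
    Integrable (fun x => f x) μ :=
  f.contMDiff.continuous.integrable_of_hasCompactSupport (HasCompactSupport.of_compactSpace _)

/-- `Dens(M)`: the smooth positive densities `ρ μ` with the same total mass as `μ`, identified with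
the functions `ρ`. -/
def Dens (n : ℕ) [ChartedSpace (EuclideanSpace ℝ (Fin n)) M] (μ : Measure M) :
    Set C^∞⟮𝓡 n, M; ℝ⟯ :=
  {ρ | (∀ x, 0 < ρ x) ∧ ∫ x, ρ x ∂μ = μ.real univ}

/-- The tangent space of `Dens(M)` (the same at every point): the smooth functions with zero
integral, with the topology induced by `C^∞(M)`. -/
def TDens (n : ℕ) [ChartedSpace (EuclideanSpace ℝ (Fin n)) M] (μ : Measure M)
    [IsFiniteMeasure μ] : Submodule ℝ C^∞⟮𝓡 n, M; ℝ⟯ where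
  carrier := {u | ∫ x, u x ∂μ = 0}
  zero_mem' := by simp
  add_mem' := by
    intro u v hu hv
    have h := integral_add (smoothFunction_integrable μ u) (smoothFunction_integrable μ v)
    simp only [mem_ofPred_eq] at hu hv ⊢
    rw [hu, hv, add_zero] at h
    simpa using h
  smul_mem' := by
    intro c u hu
    simp only [mem_ofPred_eq] at hu ⊢
    have h := integral_const_mul (μ := μ) c (fun x => u x)
    rw [hu, mul_zero] at h
    simpa using h

/-- The Fisher-Rao metric `∫ (u / ρ) (v / ρ) ρ dμ`. -/
def fisherRao (μ : Measure M) (ρ u v : C^∞⟮𝓡 n, M; ℝ⟯) : ℝ :=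
  ∫ x, (u x / ρ x) * (v x / ρ x) * ρ x ∂μ

/-- `Dens(M)` in its global affine chart `ρ ↦ ρ - 1` with values in the Fréchet space of smooth
functions with zero integral. -/
def densDomain (n : ℕ) [ChartedSpace (EuclideanSpace ℝ (Fin n)) M] (μ : Measure M)
    [IsFiniteMeasure μ] : Set (TDens n μ) :=
  {h | 1 + (h : C^∞⟮𝓡 n, M; ℝ⟯) ∈ Dens n μ}

/-- The chart covers `Dens(M)`. -/
theorem mem_Dens_iff (μ : Measure M) [IsFiniteMeasure μ] (ρ : C^∞⟮𝓡 n, M; ℝ⟯) :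
    ρ ∈ Dens n μ ↔ ∃ h ∈ densDomain n μ, ρ = 1 + (h : C^∞⟮𝓡 n, M; ℝ⟯) := by
  constructor
  · intro hρ
    refine ⟨⟨ρ - 1, ?_⟩, ?_, by simp⟩
    · have h := integral_sub (smoothFunction_integrable μ ρ)
        (smoothFunction_integrable μ (1 : C^∞⟮𝓡 n, M; ℝ⟯))
      rw [hρ.2] at h
      change ∫ x, (ρ - 1 : C^∞⟮𝓡 n, M; ℝ⟯) x ∂μ = 0
      simpa using h
    · change 1 + (ρ - 1) ∈ Dens n μ
      simpa using hρ
  · rintro ⟨h, hh, rfl⟩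
    exact hh

/-- The Fisher-Rao metric in the global chart `ρ ↦ ρ - 1`. -/
def fisherRaoMetric (n : ℕ) [ChartedSpace (EuclideanSpace ℝ (Fin n)) M] (μ : Measure M)
    [IsFiniteMeasure μ] (h u v : TDens n μ) : ℝ :=
  fisherRao μ (1 + (h : C^∞⟮𝓡 n, M; ℝ⟯)) u v

end Densities

end

noncomputable section

/-! ### `C^∞(M)` as a topological algebra -/

namespace SmoothFunction

variable {n : ℕ} {M : Type*} [TopologicalSpace M] [ChartedSpace (EuclideanSpace ℝ (Fin n)) M]

/-! ### Derivative estimates for products and inverses on an open set of a normed space. -/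

section Local

variable {E : Type*} [NormedAddCommGroup E] [NormedSpace ℝ E]

/-! Geometrically, `ρ ↦ √ρ` carries the Fisher–Rao metric to four times the `L²` metric on a sphere
of radius `√μ(M)`, whence the curvature `1 / (4 μ(M))`. The proof computes this intrinsically. On
densities of arbitrary mass, `∫ v w / ρ` has Christoffel map `-v w / (2ρ)` and is flat. The vector
`ρ` is normal to the fixed-mass densities, since it pairs with `w` to `∫ w = 0`. Hence the
Christoffel map of `Dens(M)` is `-1/2 (v w / ρ - c ρ)`, with `c` the constant making the integral
vanish (`integral_christoffel_mul`, `isLeviCivita_christoffel`). In the curvature all terms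
symmetric in `u, v` cancel. The derivative of `c ρ` leaves a factor `1/2`, the quadratic terms
remove `1/4`, and the rest is `(⟨v, w⟩ u - ⟨u, w⟩ v) / (4 μ(M))` (`curvatureTensor_christoffel`).

A weak metric has no automatic Levi-Civita connection, so existence rests on this formula;
uniqueness is Koszul's argument (`eq_of_isLeviCivita`) and needs only positivity. The analytic input
is that `C^∞(M)` is a Hausdorff topological algebra in which inversion of positive functions and
integration are continuous; Leibniz and composition bounds in charts give the algebraic operations.
-/

theorem exists_norm_iteratedFDeriv_le {f : E → ℝ} {s K : Set E} (hs : IsOpen s)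
    (hf : ContDiffOn ℝ ∞ f s) (hK : IsCompact K) (hKs : K ⊆ s) (k : ℕ) :
    ∃ C, ∀ i ≤ k, ∀ x ∈ K, ‖iteratedFDeriv ℝ i f x‖ ≤ C := by
  have h : ∀ i : ℕ, ∃ C, ∀ x ∈ K, ‖iteratedFDeriv ℝ i f x‖ ≤ C := by
    intro i
    have hc : ContinuousOn (iteratedFDeriv ℝ i f) K :=
      ((hf.continuousOn_iteratedFDerivWithin (m := i) (by exact_mod_cast le_top)
        hs.uniqueDiffOn).congr
        fun x hx => ((iteratedFDerivWithin_of_isOpen i hs) hx).symm).mono hKs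
    exact hK.exists_bound_of_continuousOn hc
  choose C hC using h
  obtain ⟨B, hB⟩ := Finset.exists_le ((Finset.range (k + 1)).image C)
  exact ⟨B, fun i hi x hx => (hC i x hx).trans
    (hB _ (Finset.mem_image_of_mem _ (Finset.mem_range.2 (by omega))))⟩

theorem norm_iteratedFDeriv_mul_le_of_isOpen {f g : E → ℝ} {s : Set E} (hs : IsOpen s)
    (hf : ContDiffOn ℝ ∞ f s) (hg : ContDiffOn ℝ ∞ g s) {x : E} (hx : x ∈ s) {k : ℕ} {A B : ℝ}
    (hA : ∀ i ≤ k, ‖iteratedFDeriv ℝ i f x‖ ≤ A) (hB : ∀ i ≤ k, ‖iteratedFDeriv ℝ i g x‖ ≤ B) :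
    ‖iteratedFDeriv ℝ k (fun y => f y * g y) x‖ ≤ 2 ^ k * (A * B) := by
  have h := norm_iteratedFDerivWithin_mul_le hf hg hs.uniqueDiffOn hx (n := k)
    (by exact_mod_cast le_top)
  rw [iteratedFDerivWithin_of_isOpen k hs hx] at h
  have hA0 : 0 ≤ A := (norm_nonneg _).trans (hA 0 (Nat.zero_le _))
  calc _ ≤ _ := h
    _ ≤ ∑ i ∈ Finset.range (k + 1), (k.choose i : ℝ) * (A * B) := by
        refine Finset.sum_le_sum fun i hi => ?_
        rw [Finset.mem_range] at hi
        rw [iteratedFDerivWithin_of_isOpen i hs hx, iteratedFDerivWithin_of_isOpen (k - i) hs hx,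
          mul_assoc]
        gcongr
        · exact hA i (by omega)
        · exact hB _ (by omega)
    _ = 2 ^ k * (A * B) := by
        rw [← Finset.sum_mul]
        congr 1
        exact_mod_cast Nat.sum_range_choose k

/-- The composition bound for `Inv.inv ∘ f`. The order of quantifiers matters: `C` is independent of
`f`, so it serves a whole neighbourhood of functions at once. -/
theorem exists_norm_iteratedFDeriv_inv_le {s : Set E} (hs : IsOpen s) {c B D : ℝ} (hc : 0 < c)
    (k : ℕ) : ∃ C, ∀ f : E → ℝ, ContDiffOn ℝ ∞ f s → (∀ x ∈ s, 0 < f x) → ∀ x ∈ s,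
      f x ∈ Icc c B → (∀ i ≤ k, ‖iteratedFDeriv ℝ i f x‖ ≤ D) →
        ‖iteratedFDeriv ℝ k (fun y => (f y)⁻¹) x‖ ≤ C := by
  have hinv : ContDiffOn ℝ ∞ (Inv.inv : ℝ → ℝ) (Ioi 0) :=
    (contDiffOn_inv ℝ).mono fun x hx => (ne_of_gt hx : x ≠ 0)
  obtain ⟨C, hC⟩ := exists_norm_iteratedFDeriv_le isOpen_Ioi hinv (isCompact_Icc (a := c) (b := B))
    (fun x hx => hc.trans_le hx.1) k
  -- The composition estimate wants the `i`-th derivative bounded by an `i`-th power; with base `max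
  -- 1 D ≥ 1` a plain bound by `D` suffices for `i ≥ 1`.
  refine ⟨k.factorial * C * (max 1 D) ^ k, fun f hf hpos x hx hfx hD => ?_⟩
  have h := norm_iteratedFDerivWithin_comp_le (n := k) (C := C) (D := max 1 D) hinv hf
    (by exact_mod_cast le_top) isOpen_Ioi.uniqueDiffOn hs.uniqueDiffOn hpos hx ?_ ?_
  · rwa [iteratedFDerivWithin_of_isOpen k hs hx] at h
  · intro i hi
    rw [iteratedFDerivWithin_of_isOpen i isOpen_Ioi (hpos x hx)]
    exact hC i hi _ hfx
  · intro i h1 hi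
    rw [iteratedFDerivWithin_of_isOpen i hs hx]
    exact (hD i hi).trans ((le_max_right 1 D).trans
      (le_self_pow₀ (le_max_left 1 D) (by omega)))

end Local

/-- A family of smooth functions is eventually bounded along a filter. -/
def EventuallyBounded {ι : Type*} (l : Filter ι) (F : ι → C^∞⟮𝓡 n, M; ℝ⟯) : Prop :=
  ∀ e ∈ atlas (EuclideanSpace ℝ (Fin n)) M, ∀ (k : ℕ) (K : Set _),
    IsCompact K → K ⊆ e.target → ∃ C, ∀ᶠ i in l, ∀ x ∈ K,
      ‖iteratedFDeriv ℝ k (fun y => F i (e.symm y)) x‖ ≤ C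

theorem EventuallyBounded.forall_le {ι : Type*} {l : Filter ι} {F : ι → C^∞⟮𝓡 n, M; ℝ⟯}
    (hF : EventuallyBounded l F) {e} (he : e ∈ atlas (EuclideanSpace ℝ (Fin n)) M) (k : ℕ)
    {K : Set _} (hK : IsCompact K) (hKe : K ⊆ e.target) : ∃ C, ∀ᶠ i in l, ∀ j ≤ k, ∀ x ∈ K,
      ‖iteratedFDeriv ℝ j (fun y => F i (e.symm y)) x‖ ≤ C := by
  induction k with
  | zero =>
    obtain ⟨C, hC⟩ := hF e he 0 K hK hKe
    exact ⟨C, hC.mono fun i hi j hj => by obtain rfl := Nat.le_zero.1 hj; exact hi⟩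
  | succ k ih =>
    obtain ⟨C, hC⟩ := ih
    obtain ⟨C', hC'⟩ := hF e he (k + 1) K hK hKe
    refine ⟨max C C', ?_⟩
    filter_upwards [hC, hC'] with i h h' j hj x hx
    rcases Nat.lt_or_eq_of_le hj with hj | rfl
    · exact (h j (by omega) x hx).trans (le_max_left _ _)
    · exact (h' x hx).trans (le_max_right _ _)

/-! ### Convergence in `C^∞(M)` by chart seminorms; ring operations and separation. -/

section IsManifold

variable [IsManifold (𝓡 n) ∞ M]

theorem contDiffOn_comp_symm (f : C^∞⟮𝓡 n, M; ℝ⟯)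
    {e : OpenPartialHomeomorph M (EuclideanSpace ℝ (Fin n))}
    (he : e ∈ atlas (EuclideanSpace ℝ (Fin n)) M) :
    ContDiffOn ℝ ∞ (fun x => f (e.symm x)) e.target := by
  rw [← contMDiffOn_iff_contDiffOn]
  exact f.contMDiff.comp_contMDiffOn (contMDiffOn_symm_of_mem_maximalAtlas
    (IsManifold.subset_maximalAtlas he))

theorem tendsto_nhds_iff {ι : Type*} {l : Filter ι} {F : ι → C^∞⟮𝓡 n, M; ℝ⟯}
    {f : C^∞⟮𝓡 n, M; ℝ⟯} :
    Tendsto F l (𝓝 f) ↔ ∀ e ∈ atlas (EuclideanSpace ℝ (Fin n)) M, ∀ (k : ℕ) (K : Set _),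
      IsCompact K → K ⊆ e.target → ∀ ε > 0, ∀ᶠ i in l, ∀ x ∈ K,
        ‖iteratedFDeriv ℝ k (fun y => (F i - f) (e.symm y)) x‖ < ε := by
  rw [smoothFunctionTopology]
  simp only [nhds_iInf, tendsto_iInf, nhds_induced, tendsto_comap_iff, Subtype.forall]
  refine forall₂_congr fun e he => forall_congr' fun k => ?_
  rw [UniformOnFun.tendsto_iff_tendstoUniformlyOn]
  simp only [mem_ofPred_eq, and_imp]
  refine forall₃_congr fun K hK hKe => ?_
  rw [Metric.tendstoUniformlyOn_iff]
  refine forall₂_congr fun ε hε => ?_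
  refine eventually_congr (Eventually.of_forall fun i => forall₂_congr fun x hx => ?_)
  have hF := ((contDiffOn_comp_symm (F i) he).contDiffAt
    (e.open_target.mem_nhds (hKe hx))).of_le (m := k) (by exact_mod_cast le_top)
  have hf := ((contDiffOn_comp_symm f he).contDiffAt
    (e.open_target.mem_nhds (hKe hx))).of_le (m := k) (by exact_mod_cast le_top)
  have h := fun_iteratedFDeriv_sub_apply hF hf
  rw [dist_comm, dist_eq_norm]
  simp only [ContMDiffMap.coe_sub, Pi.sub_apply]
  rw [h]
  rfl

theorem eventuallyBounded_const {ι : Type*} (l : Filter ι) (f : C^∞⟮𝓡 n, M; ℝ⟯) :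
    EventuallyBounded l fun _ => f := by
  intro e he k K hK hKe
  obtain ⟨C, hC⟩ := exists_norm_iteratedFDeriv_le e.open_target (contDiffOn_comp_symm f he) hK hKe k
  exact ⟨C, Eventually.of_forall fun _ => hC k le_rfl⟩

theorem tendsto_add {ι : Type*} {l : Filter ι} {F G : ι → C^∞⟮𝓡 n, M; ℝ⟯}
    {f g : C^∞⟮𝓡 n, M; ℝ⟯} (hF : Tendsto F l (𝓝 f)) (hG : Tendsto G l (𝓝 g)) :
    Tendsto (fun i => F i + G i) l (𝓝 (f + g)) := by
  rw [tendsto_nhds_iff] at *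
  intro e he k K hK hKe ε hε
  filter_upwards [hF e he k K hK hKe (ε / 2) (by positivity),
    hG e he k K hK hKe (ε / 2) (by positivity)] with i h1 h2 x hx
  have e1 := ((contDiffOn_comp_symm (F i - f) he).contDiffAt
    (e.open_target.mem_nhds (hKe hx))).of_le (m := k) (by exact_mod_cast le_top)
  have e2 := ((contDiffOn_comp_symm (G i - g) he).contDiffAt
    (e.open_target.mem_nhds (hKe hx))).of_le (m := k) (by exact_mod_cast le_top)
  have h := fun_iteratedFDeriv_add_apply e1 e2
  have h3 : (fun y => (F i + G i - (f + g)) (e.symm y)) =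
      fun y => (F i - f) (e.symm y) + (G i - g) (e.symm y) := by
    ext y
    simp only [ContMDiffMap.coe_sub, ContMDiffMap.coe_add, Pi.sub_apply, Pi.add_apply]
    ring
  rw [h3, h]
  exact (norm_add_le _ _).trans_lt (by linarith [h1 x hx, h2 x hx])

theorem tendsto_iff_sub_zero {ι : Type*} {l : Filter ι} {F : ι → C^∞⟮𝓡 n, M; ℝ⟯}
    {f : C^∞⟮𝓡 n, M; ℝ⟯} : Tendsto F l (𝓝 f) ↔ Tendsto (fun i => F i - f) l (𝓝 0) := by
  rw [tendsto_nhds_iff, tendsto_nhds_iff]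
  simp only [sub_zero]

/-- Leibniz. One factor is only assumed bounded because, for inversion, boundedness of `1 / g` is
available before its convergence. -/
theorem tendsto_mul_zero {ι : Type*} {l : Filter ι} {F G : ι → C^∞⟮𝓡 n, M; ℝ⟯}
    (hF : EventuallyBounded l F) (hG : Tendsto G l (𝓝 0)) :
    Tendsto (fun i => F i * G i) l (𝓝 0) := by
  rw [tendsto_nhds_iff] at *
  simp only [sub_zero] at *
  intro e he k K hK hKe ε hε
  obtain ⟨C, hC⟩ := hF.forall_le he k hK hKe
  -- Chosen so that the Leibniz bound `2 ^ k * (max C 1 * δ)` equals `ε / 2`; the maximum with `1`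
  -- keeps the denominator positive.
  set δ : ℝ := ε / (2 ^ k * (max C 1) * 2) with hδ
  have hC1 : (0 : ℝ) < max C 1 := lt_max_of_lt_right one_pos
  have hδ0 : 0 < δ := by positivity
  have hG' : ∀ᶠ i in l, ∀ j ≤ k, ∀ x ∈ K,
      ‖iteratedFDeriv ℝ j (fun y => G i (e.symm y)) x‖ < δ := by
    have : ∀ᶠ i in l, ∀ j ∈ Iic k, ∀ x ∈ K,
        ‖iteratedFDeriv ℝ j (fun y => G i (e.symm y)) x‖ < δ :=
      (eventually_all_finite (finite_Iic k)).2 fun j _ => hG e he j K hK hKe δ hδ0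
    exact this
  filter_upwards [hC, hG'] with i h1 h2 x hx
  have h := norm_iteratedFDeriv_mul_le_of_isOpen e.open_target (contDiffOn_comp_symm (F i) he)
    (contDiffOn_comp_symm (G i) he) (hKe hx) (k := k)
    (fun j hj => (h1 j hj x hx).trans (le_max_left C 1)) (fun j hj => (h2 j hj x hx).le)
  refine h.trans_lt ?_
  have : 2 ^ k * (max C 1 * δ) = ε / 2 := by rw [hδ]; field_simp
  rw [this]
  linarith

theorem EventuallyBounded.of_tendsto {ι : Type*} {l : Filter ι} {F : ι → C^∞⟮𝓡 n, M; ℝ⟯}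
    {f : C^∞⟮𝓡 n, M; ℝ⟯} (hF : Tendsto F l (𝓝 f)) : EventuallyBounded l F := by
  intro e he k K hK hKe
  obtain ⟨C, hC⟩ := exists_norm_iteratedFDeriv_le e.open_target (contDiffOn_comp_symm f he) hK hKe k
  refine ⟨1 + C, ?_⟩
  filter_upwards [tendsto_nhds_iff.1 hF e he k K hK hKe 1 one_pos] with i hi x hx
  have e1 := ((contDiffOn_comp_symm (F i - f) he).contDiffAt
    (e.open_target.mem_nhds (hKe hx))).of_le (m := k) (by exact_mod_cast le_top)
  have e2 := ((contDiffOn_comp_symm f he).contDiffAt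
    (e.open_target.mem_nhds (hKe hx))).of_le (m := k) (by exact_mod_cast le_top)
  have h := fun_iteratedFDeriv_add_apply e1 e2
  have h3 : (fun y => F i (e.symm y)) = fun y => (F i - f) (e.symm y) + f (e.symm y) := by
    ext y
    simp
  rw [h3, h]
  exact (norm_add_le _ _).trans (add_le_add (hi x hx).le (hC k le_rfl x hx))

theorem tendsto_mul {ι : Type*} {l : Filter ι} {F G : ι → C^∞⟮𝓡 n, M; ℝ⟯}
    {f g : C^∞⟮𝓡 n, M; ℝ⟯} (hF : Tendsto F l (𝓝 f)) (hG : Tendsto G l (𝓝 g)) :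
    Tendsto (fun i => F i * G i) l (𝓝 (f * g)) := by
  have h1 := tendsto_mul_zero (EventuallyBounded.of_tendsto hF) (tendsto_iff_sub_zero.1 hG)
  have h2 := tendsto_mul_zero (eventuallyBounded_const l g) (tendsto_iff_sub_zero.1 hF)
  rw [tendsto_iff_sub_zero]
  have h := tendsto_add h1 h2
  rw [add_zero] at h
  exact h.congr fun i => by ring

theorem tendsto_algebraMap (c : ℝ) :
    Tendsto (algebraMap ℝ C^∞⟮𝓡 n, M; ℝ⟯) (𝓝 c) (𝓝 (algebraMap ℝ _ c)) := by
  rw [tendsto_nhds_iff]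
  intro e he k K hK hKe ε hε
  filter_upwards [Metric.ball_mem_nhds c hε] with a ha x hx
  have h3 : (fun y => (algebraMap ℝ C^∞⟮𝓡 n, M; ℝ⟯ a - algebraMap ℝ _ c) (e.symm y)) =
      fun _ => a - c := by
    ext y
    rfl
  rw [h3]
  rcases eq_or_ne k 0 with rfl | hk
  · rw [norm_iteratedFDeriv_zero, ← dist_eq_norm]
    exact ha
  · rw [iteratedFDeriv_const_of_ne hk]
    simpa using hε

instance : IsTopologicalRing C^∞⟮𝓡 n, M; ℝ⟯ where
  continuous_add := continuous_iff_continuousAt.2 fun q =>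
    tendsto_add (continuous_fst.tendsto q) (continuous_snd.tendsto q)
  continuous_mul := continuous_iff_continuousAt.2 fun q =>
    tendsto_mul (continuous_fst.tendsto q) (continuous_snd.tendsto q)
  continuous_neg := continuous_iff_continuousAt.2 fun q => by
    have h := tendsto_mul (tendsto_const_nhds (x := (-1 : C^∞⟮𝓡 n, M; ℝ⟯)) (f := 𝓝 q)) tendsto_id
    have h3 : (fun i : C^∞⟮𝓡 n, M; ℝ⟯ => -1 * id i) = fun i => -i := by
      ext i
      simp
    rw [h3] at h
    simpa [ContinuousAt] using h

instance : ContinuousSMul ℝ C^∞⟮𝓡 n, M; ℝ⟯ :=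
  continuousSMul_of_algebraMap _ _ (continuous_iff_continuousAt.2 tendsto_algebraMap)

instance : T2Space C^∞⟮𝓡 n, M; ℝ⟯ := by
  -- If `𝓝 f ⊓ 𝓝 g` is proper, some function is close to both `f` and `g` at a given point: apply
  -- the order-zero seminorm to a singleton in a chart.
  refine t2_iff_nhds.2 fun {f g} hfg => ?_
  have h1 : Tendsto id (𝓝 f ⊓ 𝓝 g) (𝓝 f) := tendsto_id'.2 inf_le_left
  have h2 : Tendsto id (𝓝 f ⊓ 𝓝 g) (𝓝 g) := tendsto_id'.2 inf_le_right
  ext p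
  let e := chartAt (EuclideanSpace ℝ (Fin n)) p
  have hp : e.symm (e p) = p := e.left_inv (mem_chart_source _ p)
  refine eq_of_forall_dist_le fun ε hε => ?_
  have hK : {e p} ⊆ e.target := singleton_subset_iff.2 (mem_chart_target _ p)
  obtain ⟨i, hi1, hi2⟩ := ((tendsto_nhds_iff.1 h1 e (chart_mem_atlas _ p) 0 _ isCompact_singleton
    hK (ε / 2) (by positivity)).and (tendsto_nhds_iff.1 h2 e (chart_mem_atlas _ p) 0 _
    isCompact_singleton hK (ε / 2) (by positivity))).exists
  have hi1 := hi1 _ rfl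
  have hi2 := hi2 _ rfl
  rw [norm_iteratedFDeriv_zero] at hi1 hi2
  simp only [hp, id_eq, ContMDiffMap.coe_sub, Pi.sub_apply, Real.norm_eq_abs] at hi1 hi2
  rw [Real.dist_eq]
  rw [abs_lt] at hi1 hi2
  rw [abs_le]
  constructor <;> linarith

end IsManifold

/-- The pointwise inverse of a positive smooth function (zero for other functions). -/
def posInv (f : C^∞⟮𝓡 n, M; ℝ⟯) : C^∞⟮𝓡 n, M; ℝ⟯ :=
  open Classical in
  if h : ∀ x, 0 < f x then ⟨fun x => (f x)⁻¹, f.contMDiff.inv₀ fun x => (h x).ne'⟩ else 0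

theorem posInv_apply {f : C^∞⟮𝓡 n, M; ℝ⟯} (hf : ∀ x, 0 < f x) (x : M) :
    posInv f x = (f x)⁻¹ := by
  have h : posInv f = ⟨fun x => (f x)⁻¹, f.contMDiff.inv₀ fun x => (hf x).ne'⟩ := dif_pos hf
  rw [h]
  rfl

theorem mul_posInv {f : C^∞⟮𝓡 n, M; ℝ⟯} (hf : ∀ x, 0 < f x) : f * posInv f = 1 := by
  ext x
  rw [ContMDiffMap.coe_mul, Pi.mul_apply, posInv_apply hf, mul_inv_cancel₀ (hf x).ne']
  rfl

/-! ### Consequences of compactness: uniform convergence, inversion, integration. -/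

variable [IsManifold (𝓡 n) ∞ M] [CompactSpace M]

/-- Order-zero seminorms control a neighbourhood of each point, and finitely many such
neighbourhoods cover `M`. -/
theorem tendstoUniformly {ι : Type*} {l : Filter ι} {F : ι → C^∞⟮𝓡 n, M; ℝ⟯}
    {f : C^∞⟮𝓡 n, M; ℝ⟯} (hF : Tendsto F l (𝓝 f)) {ε : ℝ} (hε : 0 < ε) :
    ∀ᶠ i in l, ∀ x, |F i x - f x| < ε := by
  suffices h : ∀ᶠ i in l, ∀ x ∈ (univ : Set M), |F i x - f x| < ε by simpa using h
  refine isCompact_univ.induction_on (p := fun s => ∀ᶠ i in l, ∀ x ∈ s, |F i x - f x| < ε)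
    (by simp) (fun s t hst ht => ht.mono fun i hi x hx => hi x (hst hx))
    (fun s t hs ht => ?_) fun x _ => ?_
  · filter_upwards [hs, ht] with i h1 h2 x hx
    exact hx.elim (h1 x) (h2 x)
  · let e := chartAt (EuclideanSpace ℝ (Fin n)) x
    obtain ⟨K, hK, hKe, hKc⟩ := local_compact_nhds
      (e.open_target.mem_nhds (mem_chart_target (EuclideanSpace ℝ (Fin n)) x))
    refine ⟨e.source ∩ e ⁻¹' K, mem_nhdsWithin_of_mem_nhds (inter_mem
      (e.open_source.mem_nhds (mem_chart_source _ x))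
      ((e.continuousAt (mem_chart_source _ x)).preimage_mem_nhds hK)), ?_⟩
    filter_upwards [tendsto_nhds_iff.1 hF e (chart_mem_atlas _ x) 0 K hKc hKe ε hε] with i hi y hy
    have h := hi (e y) hy.2
    rw [norm_iteratedFDeriv_zero, e.left_inv hy.1] at h
    simpa using h

omit [IsManifold (𝓡 n) ∞ M] in
theorem exists_pos_lt {f : C^∞⟮𝓡 n, M; ℝ⟯} (hf : ∀ x, 0 < f x) : ∃ c > 0, ∀ x, c < f x := by
  rcases isEmpty_or_nonempty M with hM | hM
  · exact ⟨1, one_pos, fun x => (hM.false x).elim⟩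
  obtain ⟨x₀, -, hx₀⟩ := isCompact_univ.exists_isMinOn univ_nonempty
    f.contMDiff.continuous.continuousOn
  exact ⟨f x₀ / 2, half_pos (hf x₀), fun x => by
    have : f x₀ ≤ f x := hx₀ (mem_univ x)
    linarith [hf x₀]⟩

theorem isOpen_pos : IsOpen {f : C^∞⟮𝓡 n, M; ℝ⟯ | ∀ x, 0 < f x} := by
  rw [isOpen_iff_mem_nhds]
  intro f hf
  obtain ⟨c, hc, hcf⟩ := exists_pos_lt hf
  filter_upwards [tendstoUniformly (tendsto_id (x := 𝓝 f)) hc] with g hg x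
  have h1 := (abs_lt.1 (hg x)).1
  have h2 := hcf x
  simp only [id_eq] at h1
  linarith

theorem eventuallyBounded_posInv {f : C^∞⟮𝓡 n, M; ℝ⟯} (hf : ∀ x, 0 < f x) :
    EventuallyBounded (𝓝[{f : C^∞⟮𝓡 n, M; ℝ⟯ | ∀ x, 0 < f x}] f) posInv := by
  have hlim : Tendsto id (𝓝[{f : C^∞⟮𝓡 n, M; ℝ⟯ | ∀ x, 0 < f x}] f) (𝓝 f) :=
    tendsto_id'.2 nhdsWithin_le_nhds
  obtain ⟨c, hc, hcf⟩ := exists_pos_lt hf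
  intro e he k K hK hKe
  obtain ⟨D, hD⟩ := (EventuallyBounded.of_tendsto hlim).forall_le he k hK hKe
  obtain ⟨C, hC⟩ := exists_norm_iteratedFDeriv_inv_le (B := D) (D := D) e.open_target
    (half_pos hc) k
  refine ⟨C, ?_⟩
  filter_upwards [hD, tendstoUniformly hlim (half_pos hc), self_mem_nhdsWithin]
    with g h1 h2 hg x hx
  have h3 : (fun y => posInv g (e.symm y)) = fun y => (g (e.symm y))⁻¹ :=
    funext fun y => posInv_apply hg _
  rw [h3]
  refine hC _ (contDiffOn_comp_symm g he) (fun y _ => hg _) x (hKe hx) ⟨?_, ?_⟩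
    fun i hi => h1 i hi x hx
  · have h4 := (abs_lt.1 (h2 (e.symm x))).1
    have h5 := hcf (e.symm x)
    simp only [id_eq] at h4
    linarith
  · have h4 := h1 0 (Nat.zero_le k) x hx
    rw [norm_iteratedFDeriv_zero] at h4
    exact (le_abs_self _).trans h4

/-- From `1/g - 1/f = (1/g) (g - f) (-1/f)`: a bounded factor times one tending to zero, times a
fixed function. -/
theorem continuousOn_posInv :
    ContinuousOn posInv {f : C^∞⟮𝓡 n, M; ℝ⟯ | ∀ x, 0 < f x} := by
  intro f hf
  have hlim : Tendsto id (𝓝[{f : C^∞⟮𝓡 n, M; ℝ⟯ | ∀ x, 0 < f x}] f) (𝓝 f) :=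
    tendsto_id'.2 nhdsWithin_le_nhds
  have h1 := tendsto_mul_zero (eventuallyBounded_posInv hf) (tendsto_iff_sub_zero.1 hlim)
  have h2 := h1.mul_const (-posInv f)
  rw [zero_mul] at h2
  refine tendsto_iff_sub_zero.2 (h2.congr' ?_)
  filter_upwards [self_mem_nhdsWithin] with g hg
  simp only [id_eq]
  linear_combination (-posInv f) * mul_posInv hg + posInv g * mul_posInv hf

variable [MeasurableSpace M] [BorelSpace M]

/-- Integration against a finite measure, as a continuous linear functional on `C^∞(M)`. -/
def integralCLM (μ : Measure M) [IsFiniteMeasure μ] : C^∞⟮𝓡 n, M; ℝ⟯ →L[ℝ] ℝ where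
  toFun f := ∫ x, f x ∂μ
  map_add' f g := integral_add (smoothFunction_integrable μ f) (smoothFunction_integrable μ g)
  map_smul' c f := integral_const_mul c _
  cont := by
    refine continuous_iff_continuousAt.2 fun f => Metric.tendsto_nhds.2 fun ε hε => ?_
    -- The `+ 1` covers the zero measure.
    have hm : 0 < μ.real univ + 1 := by positivity
    filter_upwards [tendstoUniformly (tendsto_id (x := 𝓝 f)) (div_pos hε hm)] with g hg
    rw [dist_eq_norm, ← integral_sub (smoothFunction_integrable μ g) (smoothFunction_integrable μ f)]
    refine (norm_integral_le_of_norm_le_const (C := ε / (μ.real univ + 1))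
      (Eventually.of_forall fun x => (hg x).le)).trans_lt ?_
    rw [div_mul_eq_mul_div, div_lt_iff₀ hm]
    nlinarith

end SmoothFunction

/-! ### Gateaux calculus -/

/-- Index bookkeeping for the Leibniz formula in `GateauxSmoothOn.smul_affine`, where each
differentiation appends a direction. -/
theorem Fin.removeNth_castSucc_snoc {α : Type*} {k : ℕ} (h : Fin (k + 1) → α) (v : α)
    (j : Fin (k + 1)) :
    j.castSucc.removeNth (Fin.snoc h v : Fin (k + 2) → α) =
      (Fin.snoc (j.removeNth h) v : Fin (k + 1) → α) := by
  ext i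
  refine Fin.lastCases ?_ (fun i => ?_) i
  · simp [Fin.removeNth_apply]
  · simp only [Fin.removeNth_apply, Fin.snoc_castSucc]
    rw [Fin.castSucc_succAbove_castSucc, Fin.snoc_castSucc]

section Calculus

variable {X Y Z : Type*} [AddCommGroup X] [Module ℝ X] [AddCommGroup Y] [Module ℝ Y]
  [TopologicalSpace Y] [AddCommGroup Z] [Module ℝ Z] [TopologicalSpace Z]

namespace HasGateauxDerivAt

variable {f g : X → Y} {p v : X} {l m : Y}

theorem gateauxDeriv_eq [T2Space Y] (hf : HasGateauxDerivAt f p v l) : gateauxDeriv f p v = l :=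
  hf.limUnder_eq

theorem unique [T2Space Y] (hl : HasGateauxDerivAt f p v l) (hm : HasGateauxDerivAt f p v m) :
    l = m :=
  tendsto_nhds_unique hl hm

theorem congr_deriv (hf : HasGateauxDerivAt f p v l) (h : l = m) : HasGateauxDerivAt f p v m :=
  h ▸ hf

theorem congr (hf : HasGateauxDerivAt f p v l)
    (h : ∀ᶠ t : ℝ in 𝓝[≠] 0, f (p + t • v) = g (p + t • v)) (hp : f p = g p) :
    HasGateauxDerivAt g p v l :=
  Tendsto.congr' (h.mono fun t ht => by rw [ht, hp]) hf

/-- Continuity along one line only, which is all that the product rules require. -/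
theorem tendsto [ContinuousAdd Y] [ContinuousSMul ℝ Y] (hf : HasGateauxDerivAt f p v l) :
    Tendsto (fun t : ℝ => f (p + t • v)) (𝓝[≠] 0) (𝓝 (f p)) := by
  have h0 : Tendsto (fun t : ℝ => t) (𝓝[≠] 0) (𝓝 0) := nhdsWithin_le_nhds
  have h := (h0.smul hf).add_const (f p)
  rw [zero_smul, zero_add] at h
  refine h.congr' ?_
  filter_upwards [self_mem_nhdsWithin] with t ht
  rw [smul_inv_smul₀ ht, sub_add_cancel]

theorem const (y : Y) : HasGateauxDerivAt (fun _ : X => y) p v 0 := by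
  simp only [HasGateauxDerivAt, sub_self, smul_zero]
  exact tendsto_const_nhds

theorem add [ContinuousAdd Y] (hf : HasGateauxDerivAt f p v l) (hg : HasGateauxDerivAt g p v m) :
    HasGateauxDerivAt (fun q => f q + g q) p v (l + m) :=
  (Tendsto.add hf hg).congr fun t => by rw [← smul_add, add_sub_add_comm]

theorem sum [ContinuousAdd Y] {ι : Type*} {s : Finset ι} {f : ι → X → Y} {l : ι → Y}
    (hf : ∀ i ∈ s, HasGateauxDerivAt (f i) p v (l i)) :
    HasGateauxDerivAt (fun q => ∑ i ∈ s, f i q) p v (∑ i ∈ s, l i) :=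
  (tendsto_finsetSum s hf).congr fun t => by rw [← Finset.smul_sum, Finset.sum_sub_distrib]

theorem clm_comp (L : Y →L[ℝ] Z) (hf : HasGateauxDerivAt f p v l) :
    HasGateauxDerivAt (fun q => L (f q)) p v (L l) :=
  ((L.continuous.tendsto l).comp hf).congr fun t => by
    simp only [Function.comp_apply, map_smul, map_sub]

theorem smul [ContinuousAdd Y] [ContinuousSMul ℝ Y] {c : X → ℝ} {c' : ℝ}
    (hc : HasGateauxDerivAt c p v c') (hf : HasGateauxDerivAt f p v l) :
    HasGateauxDerivAt (fun q => c q • f q) p v (c' • f p + c p • l) := by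
  have h := (Tendsto.smul hc hf.tendsto).add (hf.const_smul (c p))
  refine h.congr fun t => ?_
  simp only [smul_eq_mul, smul_sub, smul_smul, mul_sub, sub_smul, mul_comm (c p)]
  abel

end HasGateauxDerivAt

theorem hasGateauxDerivAt_affine (y : Y) (L : X →ₗ[ℝ] Y) (p v : X) :
    HasGateauxDerivAt (fun q => y + L q) p v (L v) := by
  refine tendsto_const_nhds.congr' ?_
  filter_upwards [self_mem_nhdsWithin] with t ht
  rw [map_add, map_smul, add_sub_add_left_eq_sub, add_sub_cancel_left, inv_smul_smul₀ ht]

theorem HasGateauxDerivAt.mul {A : Type*} [CommRing A] [Algebra ℝ A] [TopologicalSpace A]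
    [IsTopologicalRing A] [ContinuousSMul ℝ A] {f g : X → A} {p v : X} {l m : A}
    (hf : HasGateauxDerivAt f p v l) (hg : HasGateauxDerivAt g p v m) :
    HasGateauxDerivAt (fun q => f q * g q) p v (l * g p + f p * m) := by
  have h := (Tendsto.mul hf hg.tendsto).add (Tendsto.const_mul (f p) hg)
  refine h.congr fun t => ?_
  rw [smul_mul_assoc, mul_smul_comm, ← smul_add]
  congr 1
  ring

variable [TopologicalSpace X]

theorem eventually_add_smul_mem [ContinuousAdd X] [ContinuousSMul ℝ X] {U : Set X} (hU : IsOpen U)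
    {p : X} (hp : p ∈ U) (v : X) : ∀ᶠ t : ℝ in 𝓝[≠] 0, p + t • v ∈ U := by
  have h : Continuous fun t : ℝ => p + t • v := by fun_prop
  refine nhdsWithin_le_nhds ((h.tendsto 0).eventually_mem (hU.mem_nhds ?_))
  simpa using hp

theorem HasGateauxDerivAt.congr_of_eqOn [ContinuousAdd X] [ContinuousSMul ℝ X] {U : Set X}
    (hU : IsOpen U) {f g : X → Y} {p v : X} {l : Y} (hf : HasGateauxDerivAt f p v l) (hp : p ∈ U)
    (h : EqOn f g U) : HasGateauxDerivAt g p v l :=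
  hf.congr ((eventually_add_smul_mem hU hp v).mono fun _ ht => h ht) (h hp)

/-- No differentiability is needed: the difference quotients agree for small `t ≠ 0`, so their
`limUnder` coincide even as junk values. -/
theorem gateauxDeriv_congr_of_eqOn [ContinuousAdd X] [ContinuousSMul ℝ X] {U : Set X}
    (hU : IsOpen U) {f g : X → Y} {p : X} (v : X) (hp : p ∈ U) (h : EqOn f g U) :
    gateauxDeriv f p v = gateauxDeriv g p v := by
  have h1 : (fun t : ℝ => t⁻¹ • (f (p + t • v) - f p)) =ᶠ[𝓝[≠] 0]
      fun t : ℝ => t⁻¹ • (g (p + t • v) - g p) :=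
    (eventually_add_smul_mem hU hp v).mono fun t ht => by simp only [h ht, h hp]
  rw [gateauxDeriv, gateauxDeriv, limUnder, limUnder, map_congr h1]

namespace GateauxSmoothOn

variable {U : Set X} {f g : X → Y}

theorem hasGateauxDerivAt [ContinuousAdd X] [ContinuousSMul ℝ X] [T2Space Y] (hU : IsOpen U)
    (hf : GateauxSmoothOn f U) {p : X} (hp : p ∈ U) (v : X) :
    HasGateauxDerivAt f p v (gateauxDeriv f p v) := by
  obtain ⟨D, h0, -, h⟩ := hf
  have h1 := (h 0 p hp Fin.elim0 v).congr_of_eqOn hU hp (g := f) fun q hq => h0 q hq _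
  rwa [h1.gateauxDeriv_eq]

theorem const (y : Y) (U : Set X) : GateauxSmoothOn (fun _ => y) U := by
  refine ⟨fun k _ _ => if k = 0 then y else 0, by simp, fun k => continuousOn_const,
    fun k p _ h v => ?_⟩
  simpa using HasGateauxDerivAt.const _

theorem congr (hf : GateauxSmoothOn f U) (h : EqOn f g U) : GateauxSmoothOn g U := by
  obtain ⟨D, h0, hc, hd⟩ := hf
  exact ⟨D, fun p hp v => (h0 p hp v).trans (h hp), hc, hd⟩

theorem add [ContinuousAdd Y] (hf : GateauxSmoothOn f U) (hg : GateauxSmoothOn g U) :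
    GateauxSmoothOn (fun q => f q + g q) U := by
  obtain ⟨D, h0, hc, hd⟩ := hf
  obtain ⟨D', h0', hc', hd'⟩ := hg
  exact ⟨fun k p h => D k p h + D' k p h, fun p hp h => by simp only [h0 p hp, h0' p hp],
    fun k => (hc k).add (hc' k), fun k p hp h v => (hd k p hp h v).add (hd' k p hp h v)⟩

theorem clm_comp (L : Y →L[ℝ] Z) (hf : GateauxSmoothOn f U) :
    GateauxSmoothOn (fun q => L (f q)) U := by
  obtain ⟨D, h0, hc, hd⟩ := hf
  exact ⟨fun k p h => L (D k p h), fun p hp h => by simp only [h0 p hp],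
    fun k => L.continuous.comp_continuousOn (hc k), fun k p hp h v => (hd k p hp h v).clm_comp L⟩

/-- An affine factor can be differentiated at most once, so Leibniz leaves one main term plus one
term for each direction spent on that factor. This handles the term `c ρ` of the Christoffel map. -/
theorem smul_affine [ContinuousAdd Y] [ContinuousSMul ℝ Y] {c : X → ℝ} (hc : GateauxSmoothOn c U)
    (y : Y) (L : X →L[ℝ] Y) : GateauxSmoothOn (fun q => c q • (y + L q)) U := by
  obtain ⟨D, h0, hD, hd⟩ := hc
  let S : (k : ℕ) → X → (Fin k → X) → Y := fun k p => match k with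
    | 0 => fun _ => 0
    | k + 1 => fun h => ∑ i : Fin (k + 1), D k p (i.removeNth h) • L (h i)
  refine ⟨fun k p h => D k p h • (y + L p) + S k p h, fun p hp h => ?_, fun k => ?_,
    fun k p hp h v => ?_⟩
  · simp only [S, h0 p hp, add_zero]
  · refine ((hD k).smul (by fun_prop)).add ?_
    cases k with
    | zero => exact continuousOn_const
    | succ k =>
      refine continuousOn_finsetSum _ fun i _ => ContinuousOn.smul ?_ (by fun_prop)
      refine (hD k).comp (f := fun q : X × (Fin (k + 1) → X) => (q.1, i.removeNth q.2))
        (Continuous.continuousOn ?_) fun q hq => ⟨hq.1, mem_univ _⟩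
      exact continuous_fst.prodMk (continuous_pi fun j =>
        (continuous_apply (i.succAbove j)).comp continuous_snd)
  · have h1 := (hd k p hp h v).smul (hasGateauxDerivAt_affine y L.toLinearMap p v)
    have h2 : HasGateauxDerivAt (fun q => S k q h) p v
        (∑ i : Fin k, D k p (i.castSucc.removeNth (Fin.snoc h v : Fin (k + 1) → X)) • L (h i)) := by
      cases k with
      | zero => simpa [S] using HasGateauxDerivAt.const (0 : Y)
      | succ k =>
        refine HasGateauxDerivAt.sum fun i _ => ?_
        have h3 := (hd k p hp (i.removeNth h) v).smul (HasGateauxDerivAt.const (L (h i)))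
        rw [smul_zero, add_zero] at h3
        rwa [Fin.removeNth_castSucc_snoc]
    change HasGateauxDerivAt (fun q => D k q h • (y + L.toLinearMap q) + S k q h) p v _
    convert h1.add h2 using 1
    -- The last summand, with the new direction spent on the affine factor, comes from
    -- differentiating the main term; the others come from differentiating `S k`.
    have h4 : S (k + 1) p (Fin.snoc h v : Fin (k + 1) → X) = ∑ i : Fin (k + 1),
        D k p (i.removeNth (Fin.snoc h v : Fin (k + 1) → X)) •
          L ((Fin.snoc h v : Fin (k + 1) → X) i) := rfl
    beta_reduce
    rw [h4, Fin.sum_univ_castSucc]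
    simp only [Fin.snoc_castSucc, Fin.snoc_last, Fin.removeNth_last, Fin.init_snoc,
      ContinuousLinearMap.coe_coe]
    abel

end GateauxSmoothOn

end Calculus

/-! ### Uniqueness of the Levi-Civita connection, and rescaling of the metric -/

section Geometry

variable {X : Type*} [AddCommGroup X] [Module ℝ X] [TopologicalSpace X]

namespace IsWeakRiemannianMetric

variable {U : Set X} {g : X → X → X → ℝ}

theorem add_right (hg : IsWeakRiemannianMetric U g) {p : X} (hp : p ∈ U) (v w w' : X) :
    g p v (w + w') = g p v w + g p v w' := by
  rw [hg.symm p hp, hg.add_left p hp, hg.symm p hp w, hg.symm p hp w']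

theorem smul_right (hg : IsWeakRiemannianMetric U g) {p : X} (hp : p ∈ U) (c : ℝ) (v w : X) :
    g p v (c • w) = c * g p v w := by
  rw [hg.symm p hp, hg.smul_left p hp, hg.symm p hp w]

theorem sub_left (hg : IsWeakRiemannianMetric U g) {p : X} (hp : p ∈ U) (v v' w : X) :
    g p (v - v') w = g p v w - g p v' w := by
  rw [sub_eq_add_neg, hg.add_left p hp, ← neg_one_smul ℝ v', hg.smul_left p hp]
  ring

theorem sub_right (hg : IsWeakRiemannianMetric U g) {p : X} (hp : p ∈ U) (v w w' : X) :
    g p v (w - w') = g p v w - g p v w' := by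
  rw [hg.symm p hp, hg.sub_left hp, hg.symm p hp w, hg.symm p hp w']

/-- Strict Cauchy–Schwarz: `⟨v, v⟩ u - ⟨u, v⟩ v` is nonzero and its squared norm is `⟨v, v⟩` times
the Gram determinant. -/
theorem gram_pos (hg : IsWeakRiemannianMetric U g) {p : X} (hp : p ∈ U) {u v : X}
    (huv : LinearIndependent ℝ ![u, v]) : 0 < g p u u * g p v v - g p u v ^ 2 := by
  have hv : 0 < g p v v := hg.pos p hp v (huv.ne_zero 1)
  have hne : g p v v • u - g p u v • v ≠ 0 := by
    intro h
    have := LinearIndependent.pair_iff.1 huv (g p v v) (-g p u v) (by rw [neg_smul, ← sub_eq_add_neg, h])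
    exact hv.ne' this.1
  have h := hg.pos p hp _ hne
  have h1 : g p (g p v v • u - g p u v • v) (g p v v • u - g p u v • v) =
      g p v v * (g p u u * g p v v - g p u v ^ 2) := by
    simp only [hg.sub_left hp, hg.sub_right hp, hg.smul_left p hp, hg.smul_right hp]
    rw [hg.symm p hp v u]
    ring
  rw [h1] at h
  exact (mul_pos_iff_of_pos_left hv).1 h

end IsWeakRiemannianMetric

theorem covariantDeriv_const [T2Space X] (Γ : X → X → X → X) (V : X → X) (w p : X) :
    covariantDeriv Γ V (fun _ => w) p = Γ p (V p) w := by
  rw [covariantDeriv, (HasGateauxDerivAt.const w).gateauxDeriv_eq, zero_add]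

namespace IsLeviCivita

variable {U : Set X} {g : X → X → X → ℝ} {Γ Γ' : X → X → X → X}

theorem hasGateauxDerivAt_metric [T2Space X] (h : IsLeviCivita U g Γ) {p : X} (hp : p ∈ U)
    (z v w : X) :
    HasGateauxDerivAt (fun q => g q v w) p z (g p (Γ p z v) w + g p v (Γ p z w)) := by
  have h1 := h.metric (fun _ => z) (fun _ => v) (fun _ => w) (.const _ _) (.const _ _)
    (.const _ _) p hp
  simpa only [covariantDeriv_const] using h1

/-- Koszul's argument on constant fields. Testing against the difference of the two candidates makes
positive definiteness sufficient; no Riesz representation enters. -/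
theorem eq_of_isLeviCivita [T2Space X] (hg : IsWeakRiemannianMetric U g) (h : IsLeviCivita U g Γ)
    (h' : IsLeviCivita U g Γ') {p : X} (hp : p ∈ U) (u v : X) : Γ p u v = Γ' p u v := by
  have key : ∀ z v w, g p (Γ p z v) w + g p (Γ p z w) v =
      g p (Γ' p z v) w + g p (Γ' p z w) v := by
    intro z v w
    have h1 := (h.hasGateauxDerivAt_metric hp z v w).unique (h'.hasGateauxDerivAt_metric hp z v w)
    rwa [hg.symm p hp v, hg.symm p hp v] at h1
  by_contra hne
  have h1 := hg.pos p hp (Γ p u v - Γ' p u v) (sub_ne_zero.2 hne)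
  set w := Γ p u v - Γ' p u v with hw
  have h2 : g p w w = g p (Γ p u v) w - g p (Γ' p u v) w := by
    conv_lhs => rw [hw]
    rw [hw, hg.sub_left hp]
  -- By symmetry of both connections, `k1 + k2 - k3` reduces to twice the pairing of `Γ p u v`,
  -- respectively `Γ' p u v`, with `w`.
  have k1 := key u v w
  have k2 := key v u w
  have k3 := key w u v
  rw [h.symm p hp v u, h'.symm p hp v u] at k2
  rw [h.symm p hp w u, h'.symm p hp w u, h.symm p hp w v, h'.symm p hp w v] at k3
  linarith

theorem curvatureTensor_eq [T2Space X] [ContinuousAdd X] [ContinuousSMul ℝ X]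
    (hg : IsWeakRiemannianMetric U g) (h : IsLeviCivita U g Γ) (h' : IsLeviCivita U g Γ')
    {p : X} (hp : p ∈ U) (u v w : X) : curvatureTensor Γ p u v w = curvatureTensor Γ' p u v w := by
  have e : ∀ a b, EqOn (fun q => Γ q a b) (fun q => Γ' q a b) U := fun a b q hq =>
    eq_of_isLeviCivita hg h h' hq a b
  simp only [curvatureTensor, gateauxDeriv_congr_of_eqOn hg.isOpen _ hp (e _ _),
    eq_of_isLeviCivita hg h h' hp]

theorem const_mul (h : IsLeviCivita U g Γ) (c : ℝ) :
    IsLeviCivita U (fun p u v => c * g p u v) Γ where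
  isAffineConnection := h.isAffineConnection
  symm := h.symm
  metric Z V W hZ hV hW p hp := by
    have h1 := (h.metric Z V W hZ hV hW p hp).clm_comp (c • ContinuousLinearMap.id ℝ ℝ)
    simpa [mul_add] using h1

end IsLeviCivita

/-- If a metric has a Levi-Civita connection whose curvature tensor has the form
`R(u, v)v = K (⟨v, v⟩ u - ⟨u, v⟩ v)`, then it has constant sectional curvature `K`. -/
theorem IsWeakRiemannianMetric.hasConstantSectionalCurvature [T2Space X] [ContinuousAdd X]
    [ContinuousSMul ℝ X] {U : Set X} {g : X → X → X → ℝ} {Γ : X → X → X → X} {K : ℝ}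
    (hg : IsWeakRiemannianMetric U g) (hΓ : IsLeviCivita U g Γ)
    (hR : ∀ p ∈ U, ∀ u v, curvatureTensor Γ p u v v = K • (g p v v • u - g p u v • v)) :
    HasConstantSectionalCurvature U g K := by
  refine ⟨⟨Γ, hΓ⟩, fun Γ' hΓ' p hp u v huv => ?_⟩
  rw [sectionalCurvature, div_eq_iff (hg.gram_pos hp huv).ne',
    IsLeviCivita.curvatureTensor_eq hg hΓ' hΓ hp, hR p hp, hg.smul_left p hp, hg.sub_left hp,
    hg.smul_left p hp, hg.smul_left p hp, hg.symm p hp v u]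
  ring

/-- Both metrics have the same Levi-Civita connections; the numerator of the curvature scales by `c`
and the Gram determinant by `c²`. -/
theorem HasConstantSectionalCurvature.const_mul {U : Set X} {g : X → X → X → ℝ} {K : ℝ}
    (h : HasConstantSectionalCurvature U g K) {c : ℝ} (hc : c ≠ 0) :
    HasConstantSectionalCurvature U (fun p u v => c * g p u v) (K / c) := by
  obtain ⟨⟨Γ, hΓ⟩, hK⟩ := h
  refine ⟨⟨Γ, hΓ.const_mul c⟩, fun Γ' hΓ' p hp u v huv => ?_⟩
  have h1 := hΓ'.const_mul c⁻¹
  simp only [inv_mul_cancel_left₀ hc] at h1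
  rw [← hK Γ' h1 p hp u v huv, sectionalCurvature, sectionalCurvature,
    show c * g p u u * (c * g p v v) - (c * g p u v) ^ 2 =
      c * (c * (g p u u * g p v v - g p u v ^ 2)) by ring, mul_div_mul_left _ _ hc, div_div,
    mul_comm c]

end Geometry

/-! ### The Fisher-Rao metric on `Dens(M)` -/

/-- In a chart, a null open set would force the positive function `r` to vanish almost everywhere on
a nonempty open set. Full support gives definiteness of the metric and, as `M` is nonempty, positive
total mass. -/
theorem IsSmoothVolume.isOpenPosMeasure {n : ℕ} {M : Type*} [TopologicalSpace M]
    [ChartedSpace (EuclideanSpace ℝ (Fin n)) M] [IsManifold (𝓡 n) ∞ M]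
    [MeasurableSpace M] [BorelSpace M] {μ : Measure M} (hμ : IsSmoothVolume n μ) :
    μ.IsOpenPosMeasure := by
  refine ⟨fun O hO ⟨x, hx⟩ h0 => ?_⟩
  let e := chartAt (EuclideanSpace ℝ (Fin n)) x
  obtain ⟨r, hr, hpos, hmap⟩ := hμ e (IsManifold.chart_mem_maximalAtlas x)
  have hV : IsOpen (e.target ∩ e.symm ⁻¹' O) := e.isOpen_inter_preimage_symm hO
  have hVne : (e.target ∩ e.symm ⁻¹' O).Nonempty := by
    refine ⟨e x, mem_chart_target _ x, ?_⟩
    rwa [mem_preimage, e.left_inv (mem_chart_source _ x)]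
  have hae : AEMeasurable e (μ.restrict e.source) :=
    e.continuousOn.aemeasurable e.open_source.measurableSet
  have h1 : (μ.restrict e.source).map e (e.target ∩ e.symm ⁻¹' O) = 0 := by
    rw [Measure.map_apply_of_aemeasurable hae hV.measurableSet]
    refine measure_mono_null_ae ?_ (Measure.restrict_le_self.absolutelyContinuous h0)
    filter_upwards [ae_restrict_mem e.open_source.measurableSet] with y hy hyV
    have h2 : e.symm (e y) ∈ O := hyV.2
    rwa [e.left_inv hy] at h2
  have hrm : AEMeasurable (fun y => ENNReal.ofReal (r y)) (volume.restrict e.target) :=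
    (hr.continuousOn.aemeasurable e.open_target.measurableSet).ennreal_ofReal
  rw [hmap, withDensity_apply _ hV.measurableSet, Measure.restrict_restrict hV.measurableSet,
    inter_eq_left.2 inter_subset_left, lintegral_eq_zero_iff' (hrm.mono_set inter_subset_left),
    EventuallyEq, ae_restrict_iff' hV.measurableSet] at h1
  refine (hV.measure_pos volume hVne).ne' (measure_mono_null (fun y hy => ?_) h1)
  change ¬ (y ∈ e.target ∩ e.symm ⁻¹' O → ENNReal.ofReal (r y) = 0)
  intro h
  exact (ENNReal.ofReal_pos.2 (hpos y hy.1)).ne' (h hy)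

namespace Dens

open SmoothFunction

variable {n : ℕ} {M : Type*} [TopologicalSpace M] [CompactSpace M]
  [ChartedSpace (EuclideanSpace ℝ (Fin n)) M] [IsManifold (𝓡 n) ∞ M]
  [MeasurableSpace M] [BorelSpace M] {μ : Measure M} [IsFiniteMeasure μ]

/-- The inverse of the density with coordinate `p`. -/
def densInv (p : TDens n μ) : C^∞⟮𝓡 n, M; ℝ⟯ := posInv (1 + (p : C^∞⟮𝓡 n, M; ℝ⟯))

theorem integral_coe (u : TDens n μ) : integralCLM μ (u : C^∞⟮𝓡 n, M; ℝ⟯) = 0 := u.2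

theorem integral_one : integralCLM μ (1 : C^∞⟮𝓡 n, M; ℝ⟯) = μ.real univ := by
  change ∫ x, (1 : ℝ) ∂μ = _
  simp

/-- The chart already fixes the total mass, so positivity is the only constraint. -/
theorem mem_densDomain_iff (p : TDens n μ) :
    p ∈ densDomain n μ ↔ ∀ x, 0 < (1 + (p : C^∞⟮𝓡 n, M; ℝ⟯)) x := by
  refine ⟨fun h => h.1, fun h => ⟨h, ?_⟩⟩
  change integralCLM μ (1 + (p : C^∞⟮𝓡 n, M; ℝ⟯)) = _
  rw [map_add, integral_one, integral_coe, add_zero]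

omit [IsManifold (𝓡 n) ∞ M] in
theorem mul_densInv {p : TDens n μ} (hp : p ∈ densDomain n μ) :
    (1 + (p : C^∞⟮𝓡 n, M; ℝ⟯)) * densInv p = 1 :=
  mul_posInv hp.1

theorem isOpen_densDomain : IsOpen (densDomain n μ) := by
  have h : densDomain n μ = (fun p : TDens n μ => 1 + (p : C^∞⟮𝓡 n, M; ℝ⟯)) ⁻¹'
      {f | ∀ x, 0 < f x} := ext mem_densDomain_iff
  rw [h]
  exact isOpen_pos.preimage (by fun_prop)

theorem continuousOn_densInv : ContinuousOn (densInv (μ := μ) (n := n)) (densDomain n μ) :=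
  continuousOn_posInv.comp (f := fun p : TDens n μ => 1 + (p : C^∞⟮𝓡 n, M; ℝ⟯))
    (by fun_prop) fun _ hp => hp.1

theorem fisherRaoMetric_eq {p : TDens n μ} (hp : p ∈ densDomain n μ) (u v : TDens n μ) :
    fisherRaoMetric n μ p u v = integralCLM μ ((u * v : C^∞⟮𝓡 n, M; ℝ⟯) * densInv p) := by
  refine integral_congr_ae (Eventually.of_forall fun x => ?_)
  have h0 : (1 + (p : C^∞⟮𝓡 n, M; ℝ⟯)) x ≠ 0 := (hp.1 x).ne'
  have h1 : densInv p x = ((1 + (p : C^∞⟮𝓡 n, M; ℝ⟯)) x)⁻¹ := posInv_apply hp.1 x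
  simp only [ContMDiffMap.coe_mul, Pi.mul_apply, h1]
  field_simp

/-- Writing `ρ_t = ρ + t v`, the difference quotient of the inverse is exactly `-(v / ρ) (1 / ρ_t)`,
so continuity of inversion gives the limit. -/
theorem hasGateauxDerivAt_densInv {p : TDens n μ} (hp : p ∈ densDomain n μ) (v : TDens n μ) :
    HasGateauxDerivAt densInv p v (-(v * densInv p ^ 2 : C^∞⟮𝓡 n, M; ℝ⟯)) := by
  have hev := eventually_add_smul_mem isOpen_densDomain hp v
  have h0 : Tendsto (fun t : ℝ => p + t • v) (𝓝[≠] 0) (𝓝[densDomain n μ] p) := by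
    refine tendsto_nhdsWithin_iff.2 ⟨?_, hev⟩
    have h : Continuous fun t : ℝ => p + t • v := by fun_prop
    simpa using (h.tendsto 0).mono_left nhdsWithin_le_nhds
  have h1 : Tendsto (fun t : ℝ => densInv (p + t • v)) (𝓝[≠] 0) (𝓝 (densInv p)) :=
    (continuousOn_densInv p hp).tendsto.comp h0
  have h2 := h1.const_mul (-(v * densInv p : C^∞⟮𝓡 n, M; ℝ⟯))
  rw [show (-(v * densInv p) * densInv p : C^∞⟮𝓡 n, M; ℝ⟯) = -(v * densInv p ^ 2) by ring] at h2
  refine h2.congr' ?_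
  filter_upwards [hev, self_mem_nhdsWithin] with t ht ht0
  rw [eq_inv_smul_iff₀ ht0]
  have e1 := mul_densInv ht
  have e2 := mul_densInv hp
  simp only [Submodule.coe_add, Submodule.coe_smul] at e1
  rw [← smul_mul_assoc, smul_neg, ← smul_mul_assoc]
  linear_combination (-densInv p) * e1 + densInv (p + t • v) * e2

theorem hasGateauxDerivAt_densInv_pow {p : TDens n μ} (hp : p ∈ densDomain n μ) (v : TDens n μ)
    (k : ℕ) : HasGateauxDerivAt (fun q => densInv q ^ k) p v
      (-((k : ℝ) • (v * densInv p ^ (k + 1)) : C^∞⟮𝓡 n, M; ℝ⟯)) := by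
  induction k with
  | zero => simpa using HasGateauxDerivAt.const (1 : C^∞⟮𝓡 n, M; ℝ⟯)
  | succ k ih =>
    have h := ih.mul (hasGateauxDerivAt_densInv hp v)
    simp only [← pow_succ] at h
    refine h.congr_deriv ?_
    simp only [Algebra.smul_def, Nat.cast_succ, map_add, map_one, map_natCast]
    ring

theorem gateauxSmoothOn_mul_densInv (a : C^∞⟮𝓡 n, M; ℝ⟯) :
    GateauxSmoothOn (fun q : TDens n μ => a * densInv q) (densDomain n μ) := by
  refine ⟨fun k p h => ((-1) ^ k * k.factorial : ℝ) •
    (a * (∏ i, (h i : C^∞⟮𝓡 n, M; ℝ⟯)) * densInv p ^ (k + 1)), fun p hp h => by simp,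
    fun k => ?_, fun k p hp h v => ?_⟩
  · have h1 : ContinuousOn (fun q : TDens n μ × (Fin k → TDens n μ) => densInv q.1)
        (densDomain n μ ×ˢ univ) := continuousOn_densInv.comp continuousOn_fst fun q hq => hq.1
    have h2 : Continuous fun q : TDens n μ × (Fin k → TDens n μ) =>
        ∏ i, (q.2 i : C^∞⟮𝓡 n, M; ℝ⟯) := by fun_prop
    exact ((continuousOn_const.mul h2.continuousOn).mul (h1.pow (k + 1))).const_smul
      ((-1) ^ k * k.factorial : ℝ)
  · have h1 := (HasGateauxDerivAt.const (p := p) (v := v)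
      (a * ∏ i, (h i : C^∞⟮𝓡 n, M; ℝ⟯))).mul (hasGateauxDerivAt_densInv_pow hp v (k + 1))
    have h2 := (HasGateauxDerivAt.const (p := p) (v := v)
      ((-1) ^ k * k.factorial : ℝ)).smul h1
    refine h2.congr_deriv ?_
    beta_reduce
    rw [Fin.prod_univ_castSucc, Nat.factorial_succ]
    simp only [Fin.snoc_castSucc, Fin.snoc_last, Algebra.smul_def, map_natCast, map_mul, map_pow,
      map_neg, map_one, map_zero, Nat.cast_mul]
    ring

theorem isWeakRiemannianMetric [μ.IsOpenPosMeasure] :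
    IsWeakRiemannianMetric (densDomain n μ) (fisherRaoMetric n μ) where
  isOpen := isOpen_densDomain
  continuousOn := by
    have h1 : ContinuousOn (fun q : TDens n μ × TDens n μ × TDens n μ => densInv q.1)
        (densDomain n μ ×ˢ univ) := continuousOn_densInv.comp continuousOn_fst fun q hq => hq.1
    have h2 : Continuous fun q : TDens n μ × TDens n μ × TDens n μ =>
        (q.2.1 * q.2.2 : C^∞⟮𝓡 n, M; ℝ⟯) := by fun_prop
    exact ((integralCLM μ).continuous.comp_continuousOn (h2.continuousOn.mul h1)).congr
      fun q hq => fisherRaoMetric_eq hq.1 _ _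
  smooth v w := ((gateauxSmoothOn_mul_densInv (v * w : C^∞⟮𝓡 n, M; ℝ⟯)).clm_comp
    (integralCLM μ)).congr fun q hq => (fisherRaoMetric_eq hq v w).symm
  add_left p hp v v' w := by
    simp only [fisherRaoMetric_eq hp, Submodule.coe_add, add_mul, map_add]
  smul_left p hp c v w := by
    simp only [fisherRaoMetric_eq hp, Submodule.coe_smul, smul_mul_assoc, map_smul, smul_eq_mul]
  symm p hp v w := by
    rw [fisherRaoMetric_eq hp, fisherRaoMetric_eq hp, mul_comm (v : C^∞⟮𝓡 n, M; ℝ⟯)]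
  pos p hp v hv := by
    rw [fisherRaoMetric_eq hp]
    obtain ⟨x, hx⟩ : ∃ x, (v : C^∞⟮𝓡 n, M; ℝ⟯) x ≠ 0 := by
      by_contra! h
      exact hv (Subtype.ext (ContMDiffMap.ext h))
    have h1 : ∀ y, 0 < densInv p y := fun y => by
      have h2 : densInv p y = ((1 + (p : C^∞⟮𝓡 n, M; ℝ⟯)) y)⁻¹ := posInv_apply hp.1 y
      rw [h2]
      exact inv_pos.2 (hp.1 y)
    -- The integrand `v² / ρ` is continuous, nonnegative and nonzero at `x`, and `μ` charges every
    -- nonempty open set.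
    refine Continuous.integral_pos_of_hasCompactSupport_nonneg_nonzero (x := x)
      (ContMDiffMap.contMDiff _).continuous (HasCompactSupport.of_compactSpace _) (fun y => ?_) ?_
    · exact mul_nonneg (mul_self_nonneg _) (h1 y).le
    · exact mul_ne_zero (mul_ne_zero hx hx) (h1 x).ne'

/-! ### The Levi-Civita connection and the curvature of the Fisher–Rao metric. -/

variable [NeZero μ]

/-- The projection of `C^∞(M)` onto the functions with zero integral along the constants. -/
def subMean (n : ℕ) [ChartedSpace (EuclideanSpace ℝ (Fin n)) M] [IsManifold (𝓡 n) ∞ M]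
    (μ : Measure M) [IsFiniteMeasure μ] [NeZero μ] : C^∞⟮𝓡 n, M; ℝ⟯ →L[ℝ] TDens n μ :=
  (ContinuousLinearMap.id ℝ C^∞⟮𝓡 n, M; ℝ⟯ -
    ((μ.real univ)⁻¹ • integralCLM μ).smulRight 1).codRestrict (TDens n μ) fun f => by
      change integralCLM μ (f - ((μ.real univ)⁻¹ * integralCLM μ f) • 1) = 0
      rw [map_sub, map_smul, integral_one, smul_eq_mul]
      field_simp [measureReal_univ_pos (μ := μ) |>.ne']
      ring

/-- The projection changes nothing in the formulas below. It makes the passage to `TDens n μ` a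
continuous linear map, so that continuity and derivatives transfer through it. -/
theorem coe_subMean {f : C^∞⟮𝓡 n, M; ℝ⟯} (hf : integralCLM μ f = 0) :
    (subMean n μ f : C^∞⟮𝓡 n, M; ℝ⟯) = f := by
  change f - ((μ.real univ)⁻¹ * integralCLM μ f) • 1 = f
  rw [hf, mul_zero, zero_smul, sub_zero]

/-- The Christoffel map `-1/2 (v w / ρ - c ρ)` of the Fisher-Rao metric, where `c` is the mean of
`v w / ρ`. -/
def christoffel (p v w : TDens n μ) : TDens n μ :=
  subMean n μ ((-1 / 2 : ℝ) • ((v * w : C^∞⟮𝓡 n, M; ℝ⟯) * densInv p -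
    ((μ.real univ)⁻¹ * integralCLM μ ((v * w : C^∞⟮𝓡 n, M; ℝ⟯) * densInv p)) • (1 + p)))

theorem coe_christoffel (p v w : TDens n μ) :
    (christoffel p v w : C^∞⟮𝓡 n, M; ℝ⟯) =
      (-1 / 2 : ℝ) • ((v * w : C^∞⟮𝓡 n, M; ℝ⟯) * densInv p -
        ((μ.real univ)⁻¹ * integralCLM μ ((v * w : C^∞⟮𝓡 n, M; ℝ⟯) * densInv p)) • (1 + p)) := by
  refine coe_subMean ?_
  rw [map_smul, map_sub, map_smul, map_add, integral_one, integral_coe, add_zero]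
  simp only [smul_eq_mul]
  field_simp [measureReal_univ_pos (μ := μ) |>.ne']
  ring

/-- The component of `christoffel` along `ρ` is normal: it contributes a multiple of `∫ w = 0`. Only
the flat part `-u v / (2ρ)` survives. -/
theorem integral_christoffel_mul {p : TDens n μ} (hp : p ∈ densDomain n μ) (u v w : TDens n μ) :
    integralCLM μ ((christoffel p u v * w : C^∞⟮𝓡 n, M; ℝ⟯) * densInv p) =
      (-1 / 2 : ℝ) * integralCLM μ ((u * v * w : C^∞⟮𝓡 n, M; ℝ⟯) * densInv p ^ 2) := by
  set c := (μ.real univ)⁻¹ * integralCLM μ ((u * v : C^∞⟮𝓡 n, M; ℝ⟯) * densInv p) with hc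
  have h : (christoffel p u v * w : C^∞⟮𝓡 n, M; ℝ⟯) * densInv p =
      (-1 / 2 : ℝ) • ((u * v * w : C^∞⟮𝓡 n, M; ℝ⟯) * densInv p ^ 2) +
        (c / 2) • (w : C^∞⟮𝓡 n, M; ℝ⟯) := by
    rw [coe_christoffel, ← hc]
    ext x
    have h1 : (1 + (p : C^∞⟮𝓡 n, M; ℝ⟯) x) * densInv p x = 1 :=
      DFunLike.congr_fun (mul_densInv hp) x
    simp only [ContMDiffMap.coe_mul, ContMDiffMap.coe_add, ContMDiffMap.coe_sub,
      ContMDiffMap.coe_smul, ContMDiffMap.coe_pow, ContMDiffMap.coe_one, Pi.mul_apply,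
      Pi.add_apply, Pi.sub_apply, Pi.smul_apply, Pi.pow_apply, Pi.one_apply, smul_eq_mul]
    linear_combination (c / 2) * (w : C^∞⟮𝓡 n, M; ℝ⟯) x * h1
  rw [h, map_add, map_smul, map_smul, integral_coe, smul_zero, add_zero, smul_eq_mul]

theorem isAffineConnection_christoffel :
    IsAffineConnection (densDomain n μ) (christoffel (n := n) (μ := μ)) where
  continuousOn := by
    have h1 : ContinuousOn (fun q : TDens n μ × TDens n μ × TDens n μ => densInv q.1)
        (densDomain n μ ×ˢ univ) := continuousOn_densInv.comp continuousOn_fst fun q hq => hq.1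
    have h2 : Continuous fun q : TDens n μ × TDens n μ × TDens n μ =>
        (q.2.1 * q.2.2 : C^∞⟮𝓡 n, M; ℝ⟯) := by fun_prop
    have h3 : Continuous fun q : TDens n μ × TDens n μ × TDens n μ =>
        (1 + q.1 : C^∞⟮𝓡 n, M; ℝ⟯) := by fun_prop
    have h4 := h2.continuousOn.mul h1
    have h5 := ((integralCLM μ).continuous.comp_continuousOn h4).const_smul (μ.real univ)⁻¹
    exact (subMean n μ).continuous.comp_continuousOn
      ((h4.sub (h5.smul h3.continuousOn)).const_smul (-1 / 2 : ℝ))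
  smooth v w := by
    have h1 := gateauxSmoothOn_mul_densInv (μ := μ) (v * w : C^∞⟮𝓡 n, M; ℝ⟯)
    have h2 := (h1.clm_comp (-(μ.real univ)⁻¹ • integralCLM μ)).smul_affine
      (1 : C^∞⟮𝓡 n, M; ℝ⟯) (TDens n μ).subtypeL
    refine ((h1.add h2).clm_comp ((-1 / 2 : ℝ) • subMean n μ)).congr fun p hp => ?_
    beta_reduce
    rw [christoffel, map_smul, smul_apply]
    congr 2
    rw [sub_eq_add_neg, ← neg_smul, ← neg_mul]
    rfl
  add_left p _ v v' w := by
    refine Subtype.ext ?_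
    simp only [Submodule.coe_add, coe_christoffel, add_mul, map_add, mul_add, add_smul, smul_add,
      smul_sub]
    abel
  smul_left p _ c v w := by
    refine Subtype.ext ?_
    simp only [Submodule.coe_smul, coe_christoffel, smul_mul_assoc, map_smul]
    rw [smul_comm c, smul_sub c, smul_smul c, smul_eq_mul, mul_left_comm]
  add_right p _ v w w' := by
    refine Subtype.ext ?_
    simp only [Submodule.coe_add, coe_christoffel, mul_add, add_mul, map_add, add_smul, smul_add,
      smul_sub]
    abel
  smul_right p _ c v w := by
    refine Subtype.ext ?_
    simp only [Submodule.coe_smul, coe_christoffel, mul_smul_comm, smul_mul_assoc, map_smul]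
    rw [smul_comm c, smul_sub c, smul_smul c, smul_eq_mul, mul_left_comm]

theorem isLeviCivita_christoffel :
    IsLeviCivita (densDomain n μ) (fisherRaoMetric n μ) christoffel where
  isAffineConnection := isAffineConnection_christoffel
  symm p _ v w := by
    rw [christoffel, christoffel, mul_comm (v : C^∞⟮𝓡 n, M; ℝ⟯)]
  metric Z V W _ hV hW p hp := by
    have hV' := (hV.hasGateauxDerivAt isOpen_densDomain hp (Z p)).clm_comp (TDens n μ).subtypeL
    have hW' := (hW.hasGateauxDerivAt isOpen_densDomain hp (Z p)).clm_comp (TDens n μ).subtypeL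
    have h := ((hV'.mul hW').mul (hasGateauxDerivAt_densInv hp (Z p))).clm_comp (integralCLM μ)
    refine (h.congr_of_eqOn isOpen_densDomain hp fun q hq =>
      (fisherRaoMetric_eq hq _ _).symm).congr_deriv ?_
    -- Differentiating `1 / ρ` produces `-∫ Z V W / ρ²`, and each of the two Christoffel terms
    -- accounts for half of it.
    have h1 := integral_christoffel_mul hp (Z p) (V p) (W p)
    have h2 := integral_christoffel_mul hp (Z p) (W p) (V p)
    have h3 : integralCLM μ ((Z p * W p * V p : C^∞⟮𝓡 n, M; ℝ⟯) * densInv p ^ 2) =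
        integralCLM μ ((Z p * V p * W p : C^∞⟮𝓡 n, M; ℝ⟯) * densInv p ^ 2) := by
      congr 1; ring
    have h4 : integralCLM μ ((V p * W p : C^∞⟮𝓡 n, M; ℝ⟯) * -((Z p : C^∞⟮𝓡 n, M; ℝ⟯) * densInv p ^ 2)) =
        -integralCLM μ ((Z p * V p * W p : C^∞⟮𝓡 n, M; ℝ⟯) * densInv p ^ 2) := by
      rw [← map_neg]; congr 1; ring
    simp only [fisherRaoMetric_eq hp, covariantDeriv, Submodule.subtypeL_apply, Submodule.coe_add,
      add_mul, mul_add, map_add, h4]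
    rw [mul_comm (V p : C^∞⟮𝓡 n, M; ℝ⟯) (christoffel p (Z p) (W p)), h1, h2, h3]
    ring

theorem hasGateauxDerivAt_christoffel {p : TDens n μ} (hp : p ∈ densDomain n μ)
    (u v w : TDens n μ) :
    HasGateauxDerivAt (fun q => christoffel q v w) p u
      (subMean n μ ((-1 / 2 : ℝ) • (-((u * v * w : C^∞⟮𝓡 n, M; ℝ⟯) * densInv p ^ 2) +
        ((μ.real univ)⁻¹ * integralCLM μ ((u * v * w : C^∞⟮𝓡 n, M; ℝ⟯) * densInv p ^ 2)) • (1 + p) -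
        ((μ.real univ)⁻¹ * integralCLM μ ((v * w : C^∞⟮𝓡 n, M; ℝ⟯) * densInv p)) • u))) := by
  have h1 := (HasGateauxDerivAt.const (p := p) (v := u) (v * w : C^∞⟮𝓡 n, M; ℝ⟯)).mul
    (hasGateauxDerivAt_densInv hp u)
  have h1 := h1.congr_deriv (m := -((u * v * w : C^∞⟮𝓡 n, M; ℝ⟯) * densInv p ^ 2)) (by ring)
  have h2 := (h1.clm_comp (-(μ.real univ)⁻¹ • integralCLM μ)).smul
    (hasGateauxDerivAt_affine (1 : C^∞⟮𝓡 n, M; ℝ⟯) (TDens n μ).subtype p u)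
  have h3 := (h1.add h2).clm_comp ((-1 / 2 : ℝ) • subMean n μ)
  refine (h3.congr_of_eqOn isOpen_densDomain hp (g := fun q => christoffel q v w)
    fun q hq => ?_).congr_deriv ?_
  · beta_reduce
    rw [christoffel, map_smul, smul_apply]
    congr 2
    rw [sub_eq_add_neg, ← neg_smul, ← neg_mul]
    rfl
  · rw [map_smul, smul_apply]
    congr 2
    simp only [smul_apply, map_neg, smul_eq_mul, Submodule.subtype_apply,
      neg_mul, neg_neg, neg_smul]
    abel

theorem coe_gateauxDeriv_christoffel {p : TDens n μ} (hp : p ∈ densDomain n μ)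
    (u v w : TDens n μ) :
    ((gateauxDeriv (fun q => christoffel q v w) p u : TDens n μ) : C^∞⟮𝓡 n, M; ℝ⟯) =
      (-1 / 2 : ℝ) • (-((u * v * w : C^∞⟮𝓡 n, M; ℝ⟯) * densInv p ^ 2) +
        ((μ.real univ)⁻¹ * integralCLM μ ((u * v * w : C^∞⟮𝓡 n, M; ℝ⟯) * densInv p ^ 2)) • (1 + p) -
        ((μ.real univ)⁻¹ * integralCLM μ ((v * w : C^∞⟮𝓡 n, M; ℝ⟯) * densInv p)) • u) := by
  rw [(hasGateauxDerivAt_christoffel hp u v w).gateauxDeriv_eq]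
  refine coe_subMean ?_
  simp only [map_smul, map_sub, map_add, map_neg, integral_one, integral_coe, smul_eq_mul]
  field_simp [measureReal_univ_pos (μ := μ) |>.ne']
  ring

/-- The curvature tensor of the Fisher-Rao metric is
`R(u, v)w = (⟨v, w⟩ u - ⟨u, w⟩ v) / (4 μ(M))`. -/
theorem curvatureTensor_christoffel {p : TDens n μ} (hp : p ∈ densDomain n μ) (u v w : TDens n μ) :
    curvatureTensor christoffel p u v w = (1 / (4 * μ.real univ)) •
      (fisherRaoMetric n μ p v w • u - fisherRaoMetric n μ p u w • v) := by
  -- The mean values inside the iterated Christoffel terms are the same multiple of `∫ u v w / ρ²`.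
  -- They are symmetric in `u, v` and cancel from the curvature.
  have e1 := integral_christoffel_mul hp v w u
  have e2 := integral_christoffel_mul hp u w v
  have e3 : (v * w * u : C^∞⟮𝓡 n, M; ℝ⟯) = u * v * w := by ring
  have e4 : (u * w * v : C^∞⟮𝓡 n, M; ℝ⟯) = u * v * w := by ring
  rw [e3, mul_comm (christoffel p v w : C^∞⟮𝓡 n, M; ℝ⟯)] at e1
  rw [e4, mul_comm (christoffel p u w : C^∞⟮𝓡 n, M; ℝ⟯)] at e2
  refine Subtype.ext ?_
  simp only [curvatureTensor, Submodule.coe_add, Submodule.coe_sub, Submodule.coe_smul,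
    coe_gateauxDeriv_christoffel hp, fisherRaoMetric_eq hp]
  rw [coe_christoffel p u (christoffel p v w), coe_christoffel p v (christoffel p u w), e1, e2,
    coe_christoffel p v w, coe_christoffel p u w, mul_comm (v : C^∞⟮𝓡 n, M; ℝ⟯) u]
  set J := integralCLM μ ((u * v * w : C^∞⟮𝓡 n, M; ℝ⟯) * densInv p ^ 2)
  set a := integralCLM μ ((v * w : C^∞⟮𝓡 n, M; ℝ⟯) * densInv p)
  set b := integralCLM μ ((u * w : C^∞⟮𝓡 n, M; ℝ⟯) * densInv p)
  have hm : 1 / (4 * μ.real univ) = 1 / 4 * (μ.real univ)⁻¹ := by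
    rw [one_div_mul_eq_div, one_div, mul_inv, div_eq_mul_inv, mul_comm]
  rw [hm]
  set m := (μ.real univ)⁻¹
  ext x
  have h1 : (1 + (p : C^∞⟮𝓡 n, M; ℝ⟯) x) * densInv p x = 1 :=
    DFunLike.congr_fun (mul_densInv hp) x
  simp only [ContMDiffMap.coe_mul, ContMDiffMap.coe_add, ContMDiffMap.coe_sub,
    ContMDiffMap.coe_smul, ContMDiffMap.coe_pow, ContMDiffMap.coe_one, ContMDiffMap.coe_neg,
    Pi.mul_apply, Pi.add_apply, Pi.sub_apply, Pi.smul_apply, Pi.pow_apply, Pi.one_apply,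
    Pi.neg_apply, smul_eq_mul]
  -- The relation `ρ * (1 / ρ) = 1` is needed only where the `ρ`-component of an inner Christoffel
  -- term is multiplied by `u / ρ` or `v / ρ`; this turns the `1/2` of the derivative terms into
  -- `1/4`.
  linear_combination (-(1 / 4) * m * a * (u : C^∞⟮𝓡 n, M; ℝ⟯) x +
    (1 / 4) * m * b * (v : C^∞⟮𝓡 n, M; ℝ⟯) x) * h1

end Dens

end

theorem mainTheorem5 {n : ℕ} {M : Type*} [TopologicalSpace M] [T2Space M] [CompactSpace M]
    [Nonempty M] [ChartedSpace (EuclideanSpace ℝ (Fin n)) M] [IsManifold (𝓡 n) ∞ M]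
    [MeasurableSpace M] [BorelSpace M]
    (μ : Measure M) [IsFiniteMeasure μ] (hμ : IsSmoothVolume n μ) :
    IsWeakRiemannianMetric (densDomain n μ) (fisherRaoMetric n μ) ∧
      0 < 1 / (4 * μ.real univ) ∧
      HasConstantSectionalCurvature (densDomain n μ) (fisherRaoMetric n μ)
        (1 / (4 * μ.real univ)) ∧
      HasConstantSectionalCurvature (densDomain n μ)
        (fun h u v => (1 / 4) * fisherRaoMetric n μ h u v) (1 / μ.real univ) := by
  have := hμ.isOpenPosMeasure
  have : NeZero μ := ⟨fun h => isOpen_univ.measure_ne_zero μ univ_nonempty (by simp [h])⟩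
  have hm : 0 < μ.real univ := measureReal_univ_pos
  have hg := Dens.isWeakRiemannianMetric (n := n) (μ := μ)
  have h := hg.hasConstantSectionalCurvature Dens.isLeviCivita_christoffel
    fun p hp u v => Dens.curvatureTensor_christoffel hp u v v
  refine ⟨hg, by positivity, h, ?_⟩
  have h4 := h.const_mul (c := 1 / 4) (by norm_num)
  rwa [show 1 / (4 * μ.real univ) / (1 / 4) = 1 / μ.real univ by field_simp] at h4
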